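/- All Banach spaces are real. For a Banach space $X$, consider bounded linear operators $T\colon X\to Y$ with values in arbitrary Banach spaces $Y$. Two operators $T_1\colon X\to Y_1$, $T_2\colon X\to Y_2$ are equivalent if $\|T_1x\|=\|T_2x\|$ for all $x\in X$; let $\mathcal{OP}(X)$ be the set of equivalence classes. The formal sum $T_1\mathbin{\tilde+}T_2\colon X\to Y_1\oplus_1Y_2$, $x\mapsto(T_1x,T_2x)$, where $\|(y_1,y_2)\|=\|y_1\|+\|y_2\|$, induces a commutative and associative operation $\tilde+$ on $\mathcal{OP}(X)$. An operator $T$ on $X$ is a strong Daugavet operator if for all $x,y\in X$ with $\|x\|=\|y\|=1$ and every $\varepsilon>0$ there is $z\in X$ with $\|z\|=1$, $\|T(z-y)\|<\varepsilon$ and $\|z+x\|>2-\varepsilon$. An operator $T$ on $X$ is narrow if $T\mathbin{\tilde+}x^*$ is a strong Daugavet operator for every continuous linear functional $x^*\in X^*$. Both properties depend only on the equivalence class of $T$. **Theorem.** Let $K$ be a perfect compact Hausdorff space (that is, a compact Hausdorff space without isolated points) and let $C(K)$ be the space of continuous functions $K\to\mathbb{R}$ with the supremum norm. Then the class of narrow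 operators on $C(K)$ is a (non-empty) subsemigroup of $(\mathcal{OP}(C(K)),\tilde+)$; that is, narrow operators on $C(K)$ exist, and if $T_1$ and $T_2$ are narrow operators on $C(K)$, then $T_1\mathbin{\tilde+}T_2$ is narrow. -/

import Mathlib

universe u v

/-- A bounded linear operator on the real normed space `X`, with values in some real Banach
space `Y`, which is part of the data. -/
structure BanachOperator (X : Type u) [NormedAddCommGroup X] [NormedSpace ℝ X] where
  /-- the range space -/
  Y : Type v
  [normedAddCommGroup : NormedAddCommGroup Y]
  [normedSpace : NormedSpace ℝ Y]
  [completeSpace : CompleteSpace Y]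
  /-- the underlying operator -/
  toCLM : X →L[ℝ] Y

namespace BanachOperator

attribute [instance] normedAddCommGroup normedSpace completeSpace

variable {X : Type u} [NormedAddCommGroup X] [NormedSpace ℝ X]

/-- Two operators are equivalent if `‖T₁ x‖ = ‖T₂ x‖` for every `x`. -/
def Equivalent (T₁ T₂ : BanachOperator.{u, v} X) : Prop :=
  ∀ x : X, ‖T₁.toCLM x‖ = ‖T₂.toCLM x‖

instance setoid : Setoid (BanachOperator.{u, v} X) where
  r := Equivalent
  iseqv := ⟨fun _ _ => rfl, fun h x => (h x).symm, fun h h' x => (h x).trans (h' x)⟩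

/-- The formal sum `x ↦ (T₁ x, T₂ x)`, an operator from `X` to the `ℓ₁`-sum `Y₁ ⊕₁ Y₂`. -/
noncomputable def formalSum (T₁ T₂ : BanachOperator.{u, v} X) : BanachOperator.{u, v} X where
  Y := WithLp 1 (T₁.Y × T₂.Y)
  toCLM := ((WithLp.prodContinuousLinearEquiv 1 ℝ T₁.Y T₂.Y).symm :
    (T₁.Y × T₂.Y) →L[ℝ] WithLp 1 (T₁.Y × T₂.Y)).comp (T₁.toCLM.prod T₂.toCLM)

theorem norm_formalSum_apply (T₁ T₂ : BanachOperator.{u, v} X) (x : X) :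
    ‖(T₁.formalSum T₂).toCLM x‖ = ‖T₁.toCLM x‖ + ‖T₂.toCLM x‖ :=
  WithLp.prod_norm_eq_of_L1 (WithLp.toLp 1 (T₁.toCLM x, T₂.toCLM x))

/-- A functional `f : X → ℝ` as an operator. (The copy `ULift ℝ` of `ℝ` only serves to put the
range space into the universe `v`.) -/
noncomputable def ofDual (f : StrongDual ℝ X) : BanachOperator.{u, v} X where
  Y := ULift.{v} ℝ
  toCLM := ((ContinuousLinearEquiv.ulift.symm : ℝ ≃L[ℝ] ULift.{v} ℝ) :
    ℝ →L[ℝ] ULift.{v} ℝ).comp f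

theorem norm_ofDual_apply (f : StrongDual ℝ X) (x : X) :
    ‖(ofDual.{u, v} f).toCLM x‖ = ‖f x‖ := rfl

/-- The tube `U_{T,ε} = {x | ‖T x‖ < ε}`. -/
def tube (T : BanachOperator.{u, v} X) (ε : ℝ) : Set X := {x | ‖T.toCLM x‖ < ε}

/-- `T` is a strong Daugavet operator if for all `x, y` in the unit sphere `S(X)` and all `ε > 0`
there is `z ∈ (y + U_{T,ε}) ∩ S(X)` with `‖z + x‖ > 2 - ε`. -/
def IsStrongDaugavet (T : BanachOperator.{u, v} X) : Prop :=
  ∀ x ∈ Metric.sphere (0 : X) 1, ∀ y ∈ Metric.sphere (0 : X) 1, ∀ ε : ℝ, 0 < ε →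
    ∃ z ∈ Metric.sphere (0 : X) 1, (∃ w ∈ T.tube ε, z = y + w) ∧ 2 - ε < ‖z + x‖

theorem isStrongDaugavet_congr {T₁ T₂ : BanachOperator.{u, v} X} (h : Equivalent T₁ T₂) :
    T₁.IsStrongDaugavet ↔ T₂.IsStrongDaugavet := by
  have ht : ∀ ε, T₁.tube ε = T₂.tube ε := fun ε => by
    ext x
    simp only [tube, Set.mem_ofPred_eq, h x]
  simp only [IsStrongDaugavet, ht]

end BanachOperator

/-- `OP(X)`: the operators on `X`, equivalent operators being identified. -/
def OP (X : Type u) [NormedAddCommGroup X] [NormedSpace ℝ X] : Type (max u (v + 1)) :=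
  Quotient (BanachOperator.setoid : Setoid (BanachOperator.{u, v} X))

namespace OP

section

variable {X : Type u} [NormedAddCommGroup X] [NormedSpace ℝ X]

/-- The equivalence class of an operator. -/
def mk (T : BanachOperator.{u, v} X) : OP.{u, v} X := Quotient.mk _ T

/-- The addition of `OP(X)` is the formal sum of operators. -/
noncomputable instance : Add (OP.{u, v} X) where
  add := Quotient.map₂ BanachOperator.formalSum fun T₁ T₁' h T₂ T₂' h' x => by
    rw [BanachOperator.norm_formalSum_apply, BanachOperator.norm_formalSum_apply, h x, h' x]

theorem mk_add_mk (T₁ T₂ : BanachOperator.{u, v} X) :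
    mk T₁ + mk T₂ = mk (T₁.formalSum T₂) := rfl

noncomputable instance : AddCommSemigroup (OP.{u, v} X) where
  add_assoc a b c := by
    induction a using Quotient.inductionOn
    induction b using Quotient.inductionOn
    induction c using Quotient.inductionOn
    refine Quotient.sound fun x => ?_
    simp only [BanachOperator.norm_formalSum_apply, add_assoc]
  add_comm a b := by
    induction a using Quotient.inductionOn
    induction b using Quotient.inductionOn
    refine Quotient.sound fun x => ?_
    simp only [BanachOperator.norm_formalSum_apply, add_comm]

/-- The formal difference of `M₂` and `M₁`: all `t ∈ OP(X)` such that `t + t₁ ∈ M₂` whenever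
`t₁ ∈ M₁`. -/
def formalDiff (M₂ M₁ : Set (OP.{u, v} X)) : Set (OP.{u, v} X) :=
  {t | ∀ t₁ ∈ M₁, t + t₁ ∈ M₂}

end

variable (X : Type u) [NormedAddCommGroup X] [NormedSpace ℝ X]

/-- The class of all strong Daugavet operators on `X`. -/
def SD : Set (OP.{u, v} X) :=
  {t | Quotient.liftOn t BanachOperator.IsStrongDaugavet fun _ _ h =>
    propext (BanachOperator.isStrongDaugavet_congr h)}

/-- The dual space `X*`, as a class of operators on `X`. -/
def dual : Set (OP.{u, v} X) :=
  Set.range fun f : StrongDual ℝ X => mk (BanachOperator.ofDual f)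

/-- The class of all narrow operators on `X`: the formal difference of the class of strong
Daugavet operators and `X*`. -/
def NAR : Set (OP.{u, v} X) := formalDiff (SD X) (dual X)

theorem mk_mem_NAR_iff (T : BanachOperator.{u, v} X) :
    mk T ∈ NAR X ↔ ∀ f : StrongDual ℝ X,
      (T.formalSum (BanachOperator.ofDual f)).IsStrongDaugavet :=
  Set.forall_mem_range

end OP

/-! On perfect `K`, narrowness is equivalent to `IsCNarrow`, a condition on bumps that is stable
under sums. Stability (`IsCNarrow.exists_common`): alternate nested bumps `a₁, b₁, a₂, b₂, ...`,
each living where the previous one is almost 1, with `T aₖ` and `S bₖ` tiny. Then `f = ∑ aₖ` and `g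
= ∑ bₖ` differ by a bounded amount, while `g` reaches about `n`. Hence `T g` is bounded along with
`S g`, and `g / n` is almost killed by both. Equivalence: a strong Daugavet operator is `C`-narrow
(`BanachOperator.IsStrongDaugavet.isCNarrow`), and conversely. Perfectness makes functionals
`C`-narrow, so adding one preserves the property. -/

section CNarrow

variable {K : Type*} [TopologicalSpace K]
  {Y : Type*} [SeminormedAddCommGroup Y] [NormedSpace ℝ Y]
  {Z : Type*} [SeminormedAddCommGroup Z] [NormedSpace ℝ Z]

/-- An operator on `C(K)` is `C`-narrow if every nonempty open set carries functions
`0 ≤ f ≤ 1` of norm almost `1` on which the operator is almost zero. -/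
def IsCNarrow (T : C(K, ℝ) →L[ℝ] Y) : Prop :=
  ∀ U : Set K, IsOpen U → U.Nonempty → ∀ ε : ℝ, 0 < ε →
    ∃ f : C(K, ℝ), (∀ x, 0 ≤ f x) ∧ (∀ x, f x ≤ 1) ∧ (∀ x ∉ U, f x = 0) ∧
      (∃ p ∈ U, 1 - ε < f p) ∧ ‖T f‖ < ε

theorem exists_bump [CompactSpace K] [T2Space K] {U : Set K} (hU : IsOpen U) {p : K} (hp : p ∈ U) :
    ∃ f : C(K, ℝ), (∀ x, 0 ≤ f x) ∧ (∀ x, f x ≤ 1) ∧ (∀ x ∉ U, f x = 0) ∧ f p = 1 := by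
  obtain ⟨f, h0, h1, h⟩ := exists_continuous_zero_one_of_isClosed hU.isClosed_compl
    (isClosed_singleton (x := p)) (by simpa using hp)
  exact ⟨f, fun x => (h x).1, fun x => (h x).2, fun x hx => h0 hx, h1 rfl⟩

/-! ### Sums of `C`-narrow operators -/

/-- The difference `f - g` nearly telescopes: a new `b` lives where the new `a` exceeds `1 - δ`, and
a new `a` lives in `V`, where `f - g` is at most `n * δ`. So each step costs only `δ`. -/
theorem IsCNarrow.exists_interlaced {T : C(K, ℝ) →L[ℝ] Y} {S : C(K, ℝ) →L[ℝ] Z}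
    (hT : IsCNarrow T) (hS : IsCNarrow S) {U : Set K} (hU : IsOpen U) (hne : U.Nonempty)
    {δ : ℝ} (hδ : 0 < δ) (n : ℕ) :
    ∃ (f g : C(K, ℝ)) (V : Set K), IsOpen V ∧ V.Nonempty ∧ V ⊆ U ∧
      (∀ x, 0 ≤ g x) ∧ (∀ x, g x ≤ n) ∧ (∀ x ∉ U, g x = 0) ∧ (∀ x ∈ V, n * (1 - δ) ≤ g x) ∧
      (∀ x, -(n * δ) ≤ f x - g x) ∧ (∀ x, f x - g x ≤ 1 + n * δ) ∧
      (∀ x ∈ V, f x - g x ≤ n * δ) ∧ ‖T f‖ ≤ n * δ ∧ ‖S g‖ ≤ n * δ := by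
  induction n with
  | zero => exact ⟨0, 0, U, hU, hne, subset_rfl, by simp, by simp, by simp, by simp, by simp,
      by simp, by simp, by simp, by simp⟩
  | succ n ih =>
    obtain ⟨f, g, V, hVo, hV, hVU, g0, gn, gU, gV, h1, h2, h3, hTf, hSg⟩ := ih
    obtain ⟨a, a0, a1, aV, ⟨p, hp, hap⟩, hTa⟩ := hT V hVo hV δ hδ
    set W : Set K := V ∩ {x | 1 - δ < a x} with hW
    have hWo : IsOpen W := hVo.inter (isOpen_lt continuous_const a.continuous)
    obtain ⟨b, b0, b1, bW, ⟨q, hq, hbq⟩, hSb⟩ := hS W hWo ⟨p, hp, hap⟩ δ hδ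
    refine ⟨f + a, g + b, W ∩ {x | 1 - δ < b x},
      hWo.inter (isOpen_lt continuous_const b.continuous), ⟨q, hq, hbq⟩,
      fun x hx => hVU hx.1.1, ?_, ?_, ?_, ?_, ?_, ?_, ?_, ?_, ?_⟩
    · intro x
      exact add_nonneg (g0 x) (b0 x)
    · intro x
      push_cast
      exact add_le_add (gn x) (b1 x)
    · intro x hx
      have : x ∉ W := fun h => hx (hVU h.1)
      simp [gU x hx, bW x this]
    · rintro x ⟨hx, hbx : 1 - δ < b x⟩
      have := gV x hx.1
      simp only [ContinuousMap.add_apply, Nat.cast_add, Nat.cast_one]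
      linarith
    · intro x
      simp only [ContinuousMap.add_apply, Nat.cast_add, Nat.cast_one]
      have := h1 x
      by_cases hx : x ∈ W
      · have h4 : 1 - δ < a x := hx.2
        linarith [b1 x]
      · linarith [bW x hx, a0 x]
    · intro x
      simp only [ContinuousMap.add_apply, Nat.cast_add, Nat.cast_one]
      by_cases hx : x ∈ V
      · linarith [h3 x hx, a1 x, b0 x]
      · linarith [h2 x, aV x hx, b0 x]
    · rintro x ⟨hx, hbx : 1 - δ < b x⟩
      simp only [ContinuousMap.add_apply, Nat.cast_add, Nat.cast_one]
      linarith [h3 x hx.1, a1 x]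
    · rw [map_add]
      push_cast
      linarith [norm_add_le (T f) (T a)]
    · rw [map_add]
      push_cast
      linarith [norm_add_le (S g) (S b)]

variable [CompactSpace K]

theorem norm_eq_one_of_abs_le {f : C(K, ℝ)} (h : ∀ x, |f x| ≤ 1) {p : K} (hp : |f p| = 1) :
    ‖f‖ = 1 :=
  le_antisymm ((f.norm_le zero_le_one).2 h) (hp ▸ f.norm_coe_le_norm p)

theorem exists_abs_gt {f : C(K, ℝ)} {c : ℝ} (hc : 0 ≤ c) (h : c < ‖f‖) : ∃ p, c < |f p| := by
  by_contra! H
  exact absurd ((f.norm_le hc).2 H) (not_le.2 h)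

theorem IsCNarrow.exists_common {T : C(K, ℝ) →L[ℝ] Y} {S : C(K, ℝ) →L[ℝ] Z}
    (hT : IsCNarrow T) (hS : IsCNarrow S) {U : Set K} (hU : IsOpen U) (hne : U.Nonempty)
    {ε : ℝ} (hε : 0 < ε) :
    ∃ f : C(K, ℝ), (∀ x, 0 ≤ f x) ∧ (∀ x, f x ≤ 1) ∧ (∀ x ∉ U, f x = 0) ∧
      (∃ p ∈ U, 1 - ε < f p) ∧ ‖T f‖ + ‖S f‖ < ε := by
  obtain ⟨n, hn⟩ := exists_nat_gt ((2 + 2 * ‖T‖) / ε)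
  have hT0 := norm_nonneg T
  have hn0 : (0 : ℝ) < n := lt_of_le_of_lt (by positivity) hn
  rw [div_lt_iff₀ hε] at hn
  -- With `δ = 1 / n` the accumulated errors total 1, independently of `n`.
  obtain ⟨f, g, V, -, ⟨p, hp⟩, hVU, g0, gn, gU, gV, h1, h2, -, hTf, hSg⟩ :=
    hT.exists_interlaced hS hU hne (δ := 1 / n) (by positivity) n
  have hn1 : (n : ℝ) * (1 / n) = 1 := by field_simp
  rw [hn1] at hTf hSg
  simp only [hn1] at h1 h2
  have hfg : ‖g - f‖ ≤ 2 := by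
    refine (ContinuousMap.norm_le _ zero_le_two).2 fun x => ?_
    rw [Real.norm_eq_abs, abs_le]
    simp only [ContinuousMap.sub_apply]
    constructor <;> linarith [h1 x, h2 x]
  have hTg : ‖T g‖ ≤ 1 + 2 * ‖T‖ := by
    have e : T g = T f + T (g - f) := by rw [← map_add]; congr 1; abel
    have := (T.le_opNorm (g - f)).trans (mul_le_mul_of_nonneg_left hfg hT0)
    rw [e]
    linarith [norm_add_le (T f) (T (g - f))]
  refine ⟨(n : ℝ)⁻¹ • g, fun x => ?_, fun x => ?_, fun x hx => ?_, ⟨p, hVU hp, ?_⟩, ?_⟩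
  · exact mul_nonneg (by positivity) (g0 x)
  · simp only [ContinuousMap.smul_apply, smul_eq_mul]
    rw [inv_mul_le_iff₀ hn0]
    linarith [gn x]
  · simp [gU x hx]
  · simp only [ContinuousMap.smul_apply, smul_eq_mul]
    rw [lt_inv_mul_iff₀ hn0]
    linarith [gV p hp]
  · rw [map_smul, map_smul, norm_smul, norm_smul, ← mul_add, Real.norm_of_nonneg (by positivity),
      inv_mul_lt_iff₀ hn0]
    linarith

/-! ### Functionals on a perfect space -/

/-- Otherwise `n` disjoint bumps in `U`, with suitable signs, add up to a function of norm at most 1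
on which `φ` is at least `n * ε`, contradicting boundedness. -/
theorem isCNarrow_of_perfectSpace [T2Space K] [PerfectSpace K] (φ : C(K, ℝ) →L[ℝ] ℝ) :
    IsCNarrow φ := by
  intro U hU hne ε hε
  by_contra! H
  have key : ∀ (n : ℕ) (V : Set K), IsOpen V → V.Nonempty → V ⊆ U →
      ∃ f : C(K, ℝ), (∀ x, |f x| ≤ 1) ∧ (∀ x ∉ V, f x = 0) ∧ n * ε ≤ φ f := by
    intro n
    induction n with
    | zero => exact fun V _ _ _ => ⟨0, by simp, by simp, by simp⟩
    | succ n ih =>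
      rintro V hV ⟨p, hp⟩ hVU
      obtain ⟨q, hqV, hqp⟩ : ∃ q ∈ V, q ≠ p := by
        have : (nhdsWithin p {p}ᶜ).NeBot := inferInstance
        obtain ⟨q, hq⟩ := this.nonempty_of_mem
          (Filter.inter_mem (mem_nhdsWithin_of_mem_nhds (hV.mem_nhds hp)) self_mem_nhdsWithin)
        exact ⟨q, hq.1, hq.2⟩
      -- `A` leaves room for the `n` earlier bumps, `B` for the new one.
      obtain ⟨A, B, hA, hB, hpA, hqB, hAB⟩ := t2_separation hqp.symm
      obtain ⟨f, f1, fA, hf⟩ := ih (V ∩ A) (hV.inter hA) ⟨p, hp, hpA⟩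
        (Set.inter_subset_left.trans hVU)
      obtain ⟨g, g0, g1, gB, gq⟩ := exists_bump (hV.inter hB) (p := q) ⟨hqV, hqB⟩
      have hg : ε ≤ |φ g| := H g g0 g1
        (fun x hx => gB x fun h => hx (hVU h.1)) ⟨q, hVU hqV, by linarith⟩
      obtain ⟨s, hs, hsg⟩ : ∃ s : ℝ, |s| = 1 ∧ ε ≤ s * φ g := by
        rcases le_abs.1 hg with h | h
        · exact ⟨1, by simp, by simpa⟩
        · exact ⟨-1, by simp, by simpa⟩
      refine ⟨f + s • g, fun x => ?_, fun x hx => ?_, ?_⟩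
      · simp only [ContinuousMap.add_apply, ContinuousMap.smul_apply, smul_eq_mul]
        by_cases hx : x ∈ A
        · rw [gB x fun h => Set.disjoint_left.1 hAB hx h.2]
          simpa using f1 x
        · rw [fA x fun h => hx h.2, zero_add, abs_mul, hs, one_mul, abs_of_nonneg (g0 x)]
          exact g1 x
      · simp [fA x fun h => hx h.1, gB x fun h => hx h.1]
      · rw [map_add, map_smul, smul_eq_mul]
        push_cast
        linarith
  obtain ⟨n, hn⟩ := exists_nat_gt (‖φ‖ / ε)
  rw [div_lt_iff₀ hε] at hn
  obtain ⟨f, f1, -, hf⟩ := key n U hU hne subset_rfl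
  have h1 : ‖f‖ ≤ 1 := (f.norm_le zero_le_one).2 f1
  have h2 := (le_abs_self _).trans (φ.le_opNorm f)
  linarith [mul_le_mul_of_nonneg_left h1 (norm_nonneg φ)]

/-! ### From `C`-narrow to strong Daugavet -/

/-- The quantitative form of the strong Daugavet condition for a `C`-narrow operator, when
`x` is almost `1` at some point. -/
theorem IsCNarrow.exists_near_one {T : C(K, ℝ) →L[ℝ] Y} (hT : IsCNarrow T) {x y : C(K, ℝ)}
    (hy : ‖y‖ = 1) {δ : ℝ} (hδ : 0 < δ) (hδ1 : δ < 1 / 4) {p : K} (hp : 1 - δ < x p) :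
    ∃ z : C(K, ℝ), ‖z‖ = 1 ∧ ‖T (z - y)‖ ≤ (2 + 3 * ‖T‖) * δ ∧ 2 - 8 * δ < ‖z + x‖ := by
  have hy1 : ∀ t, -1 ≤ y t ∧ y t ≤ 1 := fun t =>
    abs_le.1 (hy ▸ y.norm_coe_le_norm t)
  set c := y p with hc
  have hc1 := hy1 p
  obtain ⟨f, f0, f1, fU, ⟨q, ⟨hq1, hq2⟩, hq⟩, hTf⟩ := hT
    ({t | 1 - δ < x t} ∩ {t | |y t - c| < δ})
    ((isOpen_lt continuous_const x.continuous).inter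
      (isOpen_lt (y.continuous.sub continuous_const).abs continuous_const))
    ⟨p, hp, by simpa [hc] using hδ⟩ δ hδ
  simp only [Set.mem_ofPred_eq] at hq1 hq2
  rw [abs_lt] at hq2
  -- The bump lifts `y` from about `c` to about 1 at `q`, where `x` is almost 1. As `y` stays within
  -- `δ` of `c` where `f` lives, the norm exceeds 1 by at most `δ`.
  set v : C(K, ℝ) := y + (1 - c) • f with hv
  have hvt : ∀ t, v t = y t + (1 - c) * f t := fun t => by simp [hv]
  have hvle : ‖v‖ ≤ 1 + δ := by
    refine (v.norm_le (by linarith)).2 fun t => ?_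
    rw [Real.norm_eq_abs, abs_le, hvt]
    have h0 : 0 ≤ (1 - c) * f t := mul_nonneg (by linarith) (f0 t)
    refine ⟨by linarith [hy1 t], ?_⟩
    by_cases ht : t ∈ {t | 1 - δ < x t} ∩ {t | |y t - c| < δ}
    · have h2 : |y t - c| < δ := ht.2
      have h3 : (1 - c) * f t ≤ (1 - c) * 1 := mul_le_mul_of_nonneg_left (f1 t) (by linarith)
      linarith [(abs_lt.1 h2).2]
    · rw [fU t ht]
      linarith [hy1 t]
  have hvq : 1 - 3 * δ < v q := by
    rw [hvt]
    have h3 : (1 - c) * (1 - δ) ≤ (1 - c) * f q :=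
      mul_le_mul_of_nonneg_left hq.le (by linarith)
    nlinarith
  have hvlow : 1 - 3 * δ < ‖v‖ := hvq.trans_le ((le_abs_self _).trans (v.norm_coe_le_norm q))
  have hv0 : 0 < ‖v‖ := by linarith
  set z : C(K, ℝ) := ‖v‖⁻¹ • v with hz
  have hzv : ‖z - v‖ ≤ 3 * δ := by
    have e : z - v = (‖v‖⁻¹ - 1) • v := by rw [hz, sub_smul, one_smul]
    have e2 : (‖v‖⁻¹ - 1) * ‖v‖ = 1 - ‖v‖ := by field_simp
    rw [e, norm_smul, Real.norm_eq_abs, ← abs_of_nonneg (norm_nonneg v), ← abs_mul, abs_norm, e2,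
      abs_le]
    constructor <;> linarith
  refine ⟨z, ?_, ?_, ?_⟩
  · rw [hz, norm_smul, norm_inv, norm_norm, inv_mul_cancel₀ hv0.ne']
  · have e : z - y = (z - v) + (1 - c) • f := by rw [hv]; abel
    have h1 := (T.le_opNorm (z - v)).trans (mul_le_mul_of_nonneg_left hzv (norm_nonneg T))
    have h2 : (1 - c) * ‖T f‖ ≤ 2 * δ :=
      mul_le_mul (by linarith) hTf.le (norm_nonneg _) zero_le_two
    have h3 := norm_add_le (T (z - v)) ((1 - c) • T f)
    rw [norm_smul, Real.norm_of_nonneg (by linarith : (0 : ℝ) ≤ 1 - c)] at h3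
    rw [e, map_add, map_smul]
    linarith
  · have h1 : v q + x q ≤ ‖v + x‖ := (le_abs_self _).trans ((v + x).norm_coe_le_norm q)
    have h2 : ‖v + x‖ ≤ ‖z + x‖ + ‖z - v‖ := by
      have e : v + x = (z + x) - (z - v) := by abel
      rw [e]
      exact norm_sub_le _ _
    linarith

theorem IsCNarrow.isStrongDaugavet {K : Type u} [TopologicalSpace K] [CompactSpace K]
    {T : BanachOperator.{u, v} C(K, ℝ)} (hT : IsCNarrow T.toCLM) : T.IsStrongDaugavet := by
  intro x hx y hy ε hε
  rw [mem_sphere_zero_iff_norm] at hx hy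
  have hT0 := norm_nonneg T.toCLM
  obtain ⟨δ, hδ, hδ1, hδε⟩ : ∃ δ : ℝ, 0 < δ ∧ δ < 1 / 4 ∧ (8 + 3 * ‖T.toCLM‖) * δ < ε := by
    refine ⟨min (1 / 8) (ε / (2 * (8 + 3 * ‖T.toCLM‖))), by positivity,
      (min_le_left _ _).trans_lt (by norm_num), ?_⟩
    calc (8 + 3 * ‖T.toCLM‖) * min (1 / 8) (ε / (2 * (8 + 3 * ‖T.toCLM‖)))
        ≤ (8 + 3 * ‖T.toCLM‖) * (ε / (2 * (8 + 3 * ‖T.toCLM‖))) :=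
          mul_le_mul_of_nonneg_left (min_le_right _ _) (by positivity)
      _ = ε / 2 := by field_simp
      _ < ε := by linarith
  have hδT : (2 + 3 * ‖T.toCLM‖) * δ < ε := by linarith
  have hδ8 : 8 * δ < ε := by linarith [mul_nonneg hT0 hδ.le]
  obtain ⟨p, hp⟩ := exists_abs_gt (f := x) (c := 1 - δ) (by linarith) (by linarith)
  rcases lt_abs.1 hp with hp | hp
  · obtain ⟨z, hz, hzT, hzx⟩ := hT.exists_near_one hy hδ hδ1 hp
    exact ⟨z, by simpa using hz, ⟨z - y, hzT.trans_lt hδT, by abel⟩, by linarith⟩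
  -- If `x` is almost `-1` at `p`, change the signs of `x`, `y` and `z`.
  · obtain ⟨z, hz, hzT, hzx⟩ := hT.exists_near_one (x := -x) (y := -y) (by rwa [norm_neg]) hδ hδ1 hp
    refine ⟨-z, by simpa using hz, ⟨-z - y, ?_, by abel⟩, ?_⟩
    · have e : -z - y = -(z - -y) := by abel
      change ‖T.toCLM (-z - y)‖ < ε
      rw [e, map_neg, norm_neg]
      exact hzT.trans_lt hδT
    · have e : -z + x = -(z + -x) := by abel
      rw [e, norm_neg]
      linarith

/-! ### From strong Daugavet to `C`-narrow -/

/-- Each step adds `w = z - y` with `T w` small, gaining almost 2 on a smaller open set. Elsewhere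
nothing accumulates: `y ≤ S` gives `S + w ≥ z ≥ -1`, and `y = S` off `U` gives `S + w = z ≤ 1`
there. -/
theorem BanachOperator.IsStrongDaugavet.exists_partial_sum {K : Type u} [TopologicalSpace K]
    [CompactSpace K] [T2Space K] {T : BanachOperator.{u, v} C(K, ℝ)} (hT : T.IsStrongDaugavet)
    {U : Set K} (hU : IsOpen U) (hne : U.Nonempty) {δ : ℝ} (hδ : 0 < δ) (hδ1 : δ < 1) (n : ℕ) :
    ∃ (S : C(K, ℝ)) (V : Set K), IsOpen V ∧ V.Nonempty ∧ V ⊆ U ∧ (∀ x, -1 ≤ S x) ∧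
      (∀ x, S x ≤ 2 * n) ∧ (∀ x ∉ U, S x ≤ 1) ∧ (∀ x ∈ V, n * (2 - 4 * δ) ≤ S x) ∧
      ‖T.toCLM S‖ ≤ n * δ := by
  induction n with
  | zero => exact ⟨0, U, hU, hne, subset_rfl, by simp, by simp, by simp, by simp, by simp⟩
  | succ n ih =>
    obtain ⟨S, V, hVo, ⟨p, hp⟩, hVU, S0, Sn, SU, SV, hTS⟩ := ih
    obtain ⟨φ, φ0, φ1, φV, φp⟩ := exists_bump hVo hp
    -- Truncating `S` at 1 puts it in the unit ball; `2 * φ` then pushes it down to `-1` at `p`.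
    let y : C(K, ℝ) := ⟨fun x => max (-1) (min 1 (S x) - 2 * φ x), by fun_prop⟩
    have hy : ∀ x, y x = max (-1) (min 1 (S x) - 2 * φ x) := fun _ => rfl
    have y0 : ∀ x, -1 ≤ y x := fun x => le_max_left _ _
    have y1 : ∀ x, y x ≤ 1 := fun x =>
      max_le (by norm_num) (by linarith [min_le_left 1 (S x), φ0 x])
    have yp : y p = -1 := by
      rw [hy, φp]
      exact max_eq_left (by linarith [min_le_left 1 (S p)])
    have yS : ∀ x, y x ≤ S x := fun x =>
      max_le (S0 x) (by linarith [min_le_right 1 (S x), φ0 x])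
    have yU : ∀ x ∉ U, y x = S x := fun x hx => by
      rw [hy, φV x fun h => hx (hVU h), min_eq_right (SU x hx), mul_zero, sub_zero,
        max_eq_right (S0 x)]
    obtain ⟨z, hz, ⟨w, hw, hzw⟩, hzφ⟩ := hT φ
      (mem_sphere_zero_iff_norm.2 (norm_eq_one_of_abs_le (p := p)
        (fun x => by rw [abs_of_nonneg (φ0 x)]; exact φ1 x) (by simp [φp])))
      y (mem_sphere_zero_iff_norm.2 (norm_eq_one_of_abs_le (p := p)
        (fun x => abs_le.2 ⟨y0 x, y1 x⟩) (by simp [yp]))) δ hδ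
    have hwz : ∀ x, w x = z x - y x := fun x => by simp [hzw]
    have z1 : ∀ x, -1 ≤ z x ∧ z x ≤ 1 := fun x =>
      abs_le.1 (mem_sphere_zero_iff_norm.1 hz ▸ z.norm_coe_le_norm x)
    obtain ⟨q, hq⟩ := exists_abs_gt (by linarith) hzφ
    -- Since `φ ≥ 0`, the large value of `z + φ` is positive, so `z` and `φ` are both almost 1 at
    -- `q`.
    have hq' : 2 - δ < z q + φ q := by
      rcases lt_abs.1 hq with h | h <;> simp only [ContinuousMap.add_apply] at h
      · exact h
      · linarith [z1 q, φ0 q]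
    have hqV : q ∈ V := by
      by_contra h
      linarith [z1 q, φV q h]
    have hyq : y q ≤ -1 + 2 * δ :=
      max_le (by linarith) (by linarith [min_le_left 1 (S q), z1 q])
    refine ⟨S + w, V ∩ {x | 2 - 4 * δ < w x},
      hVo.inter (isOpen_lt continuous_const w.continuous), ⟨q, hqV, ?_⟩,
      Set.inter_subset_left.trans hVU, ?_, ?_, ?_, ?_, ?_⟩
    · change 2 - 4 * δ < w q
      linarith [hwz q, φ1 q]
    · intro x
      rw [ContinuousMap.add_apply, hwz]
      linarith [yS x, z1 x]
    · intro x
      rw [ContinuousMap.add_apply, hwz]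
      push_cast
      linarith [Sn x, z1 x, y0 x]
    · intro x hx
      rw [ContinuousMap.add_apply, hwz, yU x hx]
      linarith [z1 x]
    · rintro x ⟨hx, hwx : 2 - 4 * δ < w x⟩
      rw [ContinuousMap.add_apply]
      push_cast
      linarith [SV x hx]
    · have hw' : ‖T.toCLM w‖ < δ := hw
      rw [map_add]
      push_cast
      linarith [norm_add_le (T.toCLM S) (T.toCLM w)]

theorem BanachOperator.IsStrongDaugavet.isCNarrow {K : Type u} [TopologicalSpace K]
    [CompactSpace K] [T2Space K] {T : BanachOperator.{u, v} C(K, ℝ)} (hT : T.IsStrongDaugavet) :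
    IsCNarrow T.toCLM := by
  intro U hU hne ε hε
  have hT0 := norm_nonneg T.toCLM
  obtain ⟨n, hn⟩ := exists_nat_gt ((3 + ‖T.toCLM‖) / ε)
  rw [div_lt_iff₀ hε] at hn
  have hnε : 0 < n * ε := by linarith
  have hn0 : (0 : ℝ) < n := pos_of_mul_pos_left hnε hε.le
  have hn1 : (1 : ℝ) ≤ n := by exact_mod_cast Nat.cast_pos.1 hn0
  obtain ⟨S, V, -, ⟨p, hp⟩, hVU, S0, Sn, SU, SV, hTS⟩ :=
    hT.exists_partial_sum hU hne (δ := 1 / (2 * n)) (by positivity)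
      (by rw [div_lt_one (by positivity)]; linarith) n
  have e1 : (n : ℝ) * (1 / (2 * n)) = 1 / 2 := by field_simp
  have e2 : (n : ℝ) * (2 - 4 * (1 / (2 * n))) = 2 * n - 2 := by field_simp; ring
  rw [e1] at hTS
  have hSp := SV p hp
  rw [e2] at hSp
  -- This vanishes off `U`, where `S ≤ 1`, and moves `S` by at most 1 since `S ≥ -1`. The error is
  -- absorbed on dividing by `2 * n`.
  let g : C(K, ℝ) := ⟨fun x => max (S x - 1) 0, by fun_prop⟩
  have hg : ∀ x, g x = max (S x - 1) 0 := fun _ => rfl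
  have hgS : ‖g - S‖ ≤ 1 := by
    refine (ContinuousMap.norm_le _ zero_le_one).2 fun x => ?_
    rw [Real.norm_eq_abs, abs_le, ContinuousMap.sub_apply, hg]
    refine ⟨by linarith [le_max_left (S x - 1) 0], ?_⟩
    have : max (S x - 1) 0 ≤ S x + 1 := max_le (by linarith) (by linarith [S0 x])
    linarith
  have hTg : ‖T.toCLM g‖ ≤ 1 / 2 + ‖T.toCLM‖ := by
    have e : T.toCLM g = T.toCLM S + T.toCLM (g - S) := by rw [← map_add]; congr 1; abel
    have := (T.toCLM.le_opNorm (g - S)).trans (mul_le_mul_of_nonneg_left hgS hT0)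
    rw [e]
    linarith [norm_add_le (T.toCLM S) (T.toCLM (g - S))]
  refine ⟨(2 * (n : ℝ))⁻¹ • g, fun x => ?_, fun x => ?_, fun x hx => ?_, ⟨p, hVU hp, ?_⟩, ?_⟩
  · exact mul_nonneg (by positivity) (le_max_right _ _)
  · rw [ContinuousMap.smul_apply, smul_eq_mul, inv_mul_le_iff₀ (by positivity), hg]
    exact max_le (by linarith [Sn x]) (by linarith)
  · rw [ContinuousMap.smul_apply, hg, max_eq_right (by linarith [SU x hx]), smul_zero]
  · rw [ContinuousMap.smul_apply, smul_eq_mul, lt_inv_mul_iff₀ (by positivity), hg]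
    exact lt_max_of_lt_left (by linarith)
  · rw [map_smul, norm_smul, Real.norm_of_nonneg (by positivity), inv_mul_lt_iff₀ (by positivity)]
    linarith

end CNarrow

/-! ### Narrow operators are the `C`-narrow ones -/

section Narrow

variable {K : Type u} [TopologicalSpace K] [CompactSpace K]

theorem IsCNarrow.formalSum {T S : BanachOperator.{u, v} C(K, ℝ)} (hT : IsCNarrow T.toCLM)
    (hS : IsCNarrow S.toCLM) : IsCNarrow (T.formalSum S).toCLM := by
  intro U hU hne ε hε
  obtain ⟨f, h⟩ := hT.exists_common hS hU hne hε
  exact ⟨f, by rwa [BanachOperator.norm_formalSum_apply]⟩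

theorem isCNarrow_ofDual [T2Space K] [PerfectSpace K] (φ : StrongDual ℝ C(K, ℝ)) :
    IsCNarrow (BanachOperator.ofDual.{u, v} φ).toCLM :=
  isCNarrow_of_perfectSpace φ

theorem BanachOperator.IsStrongDaugavet.of_formalSum_left {T S : BanachOperator.{u, v} C(K, ℝ)}
    (h : (T.formalSum S).IsStrongDaugavet) : T.IsStrongDaugavet := by
  intro x hx y hy ε hε
  obtain ⟨z, hz, ⟨w, hw, hzw⟩, hzx⟩ := h x hx y hy ε hε
  refine ⟨z, hz, ⟨w, (?_ : ‖T.toCLM w‖ ≤ _).trans_lt hw, hzw⟩, hzx⟩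
  rw [BanachOperator.norm_formalSum_apply]
  exact le_add_of_nonneg_right (norm_nonneg _)

/-- On `C(K)`, `K` perfect, an operator is narrow if and only if it is `C`-narrow. -/
theorem mk_mem_NAR_iff_isCNarrow [T2Space K] [PerfectSpace K] (T : BanachOperator.{u, v} C(K, ℝ)) :
    OP.mk T ∈ OP.NAR C(K, ℝ) ↔ IsCNarrow T.toCLM := by
  rw [OP.mk_mem_NAR_iff]
  exact ⟨fun h => (h 0).of_formalSum_left.isCNarrow,
    fun h φ => (h.formalSum (isCNarrow_ofDual φ)).isStrongDaugavet⟩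

end Narrow

/-- On `C(K)`, `K` a perfect compact Hausdorff space, the narrow operators form a (non-empty)
subsemigroup of `OP(C(K))`, whose addition is the formal sum. -/
theorem mainTheorem9 (K : Type u) [TopologicalSpace K] [CompactSpace K] [T2Space K]
    [PerfectSpace K] :
    (OP.NAR.{u, v} C(K, ℝ)).Nonempty ∧
      ∃ S : AddSubsemigroup (OP.{u, v} C(K, ℝ)), (S : Set (OP.{u, v} C(K, ℝ))) = OP.NAR C(K, ℝ) := by
  refine ⟨⟨OP.mk (BanachOperator.ofDual 0), (mk_mem_NAR_iff_isCNarrow _).2 (isCNarrow_ofDual 0)⟩,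
    ⟨OP.NAR C(K, ℝ), ?_⟩, rfl⟩
  intro a b ha hb
  induction a using Quotient.inductionOn with | _ T
  induction b using Quotient.inductionOn with | _ S
  exact (mk_mem_NAR_iff_isCNarrow _).2 (((mk_mem_NAR_iff_isCNarrow T).1 ha).formalSum
    ((mk_mem_NAR_iff_isCNarrow S).1 hb))
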